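/- Let $\mathbb{Z}_2$ be the ring of 2-adic integers with absolute value $|\cdot|_2$ normalized by $|2|_2=1/2$, and let $\mu_2$ be the Haar measure on $\mathbb{Z}_2$ with $\mu_2(\mathbb{Z}_2)=1$. For $x\in\mathbb{Z}_2$ and $i\ge 0$ let $\delta_i(x)\in\{0,1\}$ be the $i$-th binary digit of $x$, so that $x=\sum_{i=0}^\infty \delta_i(x)2^i$. A map $f\colon\mathbb{Z}_2\to\mathbb{Z}_2$ is called a T-function if for every $i\ge 0$ the digit $\delta_i(f(x))$ depends only on $\delta_0(x),\dots,\delta_i(x)$ (equivalently, $|f(x)-f(y)|_2\le|x-y|_2$ for all $x,y\in\mathbb{Z}_2$). It is called ergodic if it preserves $\mu_2$ and every Borel set $S$ with $f^{-1}(S)=S$ satisfies $\mu_2(S)\in\{0,1\}$. Let $c,c_0,c_1,c_2,\dots$ be a sequence of 2-adic integers. Then the series $$c+\sum_{i=0}^{\infty}c_i\,\delta_i(x)$$ defines an ergodic T-function $f\colon\mathbb{Z}_2\to\mathbb{Z}_2$ (that is, it converges in $\mathbb{Z}_2$ for every $x\in\mathbb{Z}_2$, and the map $f$ sending $x$ to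 its sum is a T-function and is ergodic) if and only if the following conditions hold simultaneously: 1. $c\equiv 1\pmod 2$; 2. $c_0\equiv 1\pmod 4$; 3. $|c_i|_2=2^{-i}$ for all $i=1,2,3,\dots$. -/

import Mathlib

open MeasureTheory Filter Topology

namespace TFun

/-- The `i`-th binary digit `δ_i(x) ∈ {0, 1}` of a 2-adic integer `x`: the `i`-th bit of the
least non-negative residue of `x` modulo `2 ^ (i + 1)`. -/
noncomputable def digit (i : ℕ) (x : ℤ_[2]) : ℕ :=
  (PadicInt.toZModPow (i + 1) x).val / 2 ^ i % 2

/-- `f : ℤ₂ → ℤ₂` is a (univariate) T-function: for every `i`, the `i`-th binary digit of `f x`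
depends only on the binary digits `0, …, i` of `x`. -/
def IsTFunction (f : ℤ_[2] → ℤ_[2]) : Prop :=
  ∀ (i : ℕ) (x y : ℤ_[2]), (∀ j ≤ i, digit j x = digit j y) → digit i (f x) = digit i (f y)

/-- The Borel σ-algebra on `ℤ₂`. -/
noncomputable instance instMeasurableSpace : MeasurableSpace ℤ_[2] := borel ℤ_[2]

instance instBorelSpace : BorelSpace ℤ_[2] := ⟨rfl⟩

/-- The Haar measure on the additive group `ℤ₂`, normalized so that `ℤ₂` has measure `1`. -/
noncomputable def haar : Measure ℤ_[2] := Measure.addHaarMeasure ⊤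

/-- The series `c + ∑ i, c_i δ_i(x)` converges at every `x ∈ ℤ₂`, and its sum is `f x`. -/
def SeriesDefines (c : ℤ_[2]) (a : ℕ → ℤ_[2]) (f : ℤ_[2] → ℤ_[2]) : Prop :=
  ∀ x : ℤ_[2],
    Tendsto (fun n : ℕ => c + ∑ i ∈ Finset.range n, a i * (digit i x : ℤ_[2])) atTop (𝓝 (f x))

end TFun

/-!
All congruences between 2-adic integers are written as `2 ^ n ∣ x - y`; two numbers are congruent
modulo `2 ^ n` iff their first `n` digits agree, so a T-function is one that respects congruences
modulo every `2 ^ n`. The conditions on `c` and `a` amount to `c` odd, `a 0 ≡ 1` modulo `4`, and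
`a i ≡ 2 ^ i` modulo `2 ^ (i + 1)` for all `i`.

*Sufficiency.* Since `2 ^ i ∣ a i`, the series converges to a T-function `f`, and modulo `2 ^ n` it
may be truncated after `n` terms. Comparing it with `x = ∑ 2 ^ i δ_i(x)` gives
`f y - y ≡ c + ∑_{i < k} (a i - 2 ^ i) δ_i(y)` modulo `2 ^ (k + 1)`. Adding this up over `2 ^ k`
consecutive points of an orbit, where each of the first `k` digits is `1` exactly half of the
time, the sum contributes multiples of `4 * 2 ^ (k - 1)`, so `f^[2 ^ k] x ≡ x + 2 ^ k c ≡ x + 2 ^ k`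
(`SeriesDefines.sum_digit_and_iterate`). Hence `f` is transitive modulo every power of two.
Transitivity implies ergodicity (`IsTFunction.ergodic_of_transitive`): an invariant set has the same
measure in all residue classes modulo `2 ^ n`, so it is independent of every residue class, hence of
itself.

*Necessity.* If `f` is a T-function, then `2 ^ i ∣ f (2 ^ i) - f 0 = a i`. A measure-preserving
T-function is surjective, hence injective, modulo `2 ^ n`, so `2 ^ (i + 1)` does not divide
`f (2 ^ i) - f 0`. When `c` is even, or `a 0 ≡ 3` modulo `4`, there is a union of residue classes
modulo `2`, or modulo `4`, that is invariant, nonempty and not everything, which contradicts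
ergodicity.
-/

namespace TFun

/-! ### Binary digits and congruences modulo powers of two -/

theorem toZModPow_eq_iff_pow_dvd_sub {n : ℕ} {x y : ℤ_[2]} :
    PadicInt.toZModPow n x = PadicInt.toZModPow n y ↔ (2 : ℤ_[2]) ^ n ∣ x - y := by
  rw [← sub_eq_zero, ← map_sub, ← RingHom.mem_ker, PadicInt.ker_toZModPow,
    Ideal.mem_span_singleton]
  norm_num

theorem digit_lt_two (i : ℕ) (x : ℤ_[2]) : digit i x < 2 := Nat.mod_lt _ two_pos

theorem digit_eq_zero_or_one (i : ℕ) (x : ℤ_[2]) : digit i x = 0 ∨ digit i x = 1 := by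
  have := digit_lt_two i x
  omega

theorem digit_eq_of_pow_dvd_sub {n i : ℕ} {x y : ℤ_[2]} (hi : i < n)
    (h : (2 : ℤ_[2]) ^ n ∣ x - y) : digit i x = digit i y := by
  have : PadicInt.toZModPow (i + 1) x = PadicInt.toZModPow (i + 1) y :=
    toZModPow_eq_iff_pow_dvd_sub.2 ((pow_dvd_pow _ hi).trans h)
  simp only [digit, this]

/-- The first `n` digits of `x` are the binary expansion of its residue modulo `2 ^ n`. -/
theorem val_toZModPow_eq_sum_digit (x : ℤ_[2]) (n : ℕ) :
    (PadicInt.toZModPow n x).val = ∑ i ∈ Finset.range n, digit i x * 2 ^ i := by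
  induction n with
  | zero =>
    have := ZMod.val_lt (PadicInt.toZModPow 0 x)
    simp only [pow_zero] at this
    simp only [Finset.range_zero, Finset.sum_empty]
    exact Nat.lt_one_iff.1 this
  | succ n ih =>
    rw [Finset.sum_range_succ, ← ih, ← PadicInt.cast_toZModPow n (n + 1) n.le_succ x, digit]
    have hlt := ZMod.val_lt (PadicInt.toZModPow (n + 1) x)
    rw [ZMod.cast_eq_val, ZMod.val_natCast]
    set v := (PadicInt.toZModPow (n + 1) x).val
    have : v / 2 ^ n < 2 := Nat.div_lt_of_lt_mul (by rwa [← pow_succ])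
    rw [Nat.mod_eq_of_lt this, mul_comm]
    exact (Nat.mod_add_div v (2 ^ n)).symm

theorem pow_dvd_sub_sum_digit (x : ℤ_[2]) (n : ℕ) :
    (2 : ℤ_[2]) ^ n ∣ x - ∑ i ∈ Finset.range n, 2 ^ i * (digit i x : ℤ_[2]) := by
  rw [← toZModPow_eq_iff_pow_dvd_sub]
  have h : ∑ i ∈ Finset.range n, 2 ^ i * (digit i x : ℤ_[2]) =
      (((PadicInt.toZModPow n x).val : ℕ) : ℤ_[2]) := by
    rw [val_toZModPow_eq_sum_digit]
    push_cast
    exact Finset.sum_congr rfl fun _ _ => mul_comm _ _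
  rw [h, map_natCast, ZMod.natCast_zmod_val]

theorem pow_dvd_sub_of_digit_eq {n : ℕ} {x y : ℤ_[2]} (h : ∀ i < n, digit i x = digit i y) :
    (2 : ℤ_[2]) ^ n ∣ x - y := by
  rw [← toZModPow_eq_iff_pow_dvd_sub]
  refine ZMod.val_injective _ ?_
  rw [val_toZModPow_eq_sum_digit, val_toZModPow_eq_sum_digit]
  exact Finset.sum_congr rfl fun i hi => by rw [h i (Finset.mem_range.1 hi)]

theorem not_pow_succ_dvd_pow (n : ℕ) : ¬ (2 : ℤ_[2]) ^ (n + 1) ∣ 2 ^ n := by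
  have h2 : Prime (2 : ℤ_[2]) := by exact_mod_cast PadicInt.prime_p (p := 2)
  intro h
  rw [pow_dvd_pow_iff h2.ne_zero h2.not_isUnit] at h
  omega

theorem digit_zero (j : ℕ) : digit j 0 = 0 := by simp [digit]

theorem digit_two_pow (i j : ℕ) : digit j (2 ^ i) = if j = i then 1 else 0 := by
  have h : (2 : ℤ_[2]) ^ i = ((2 ^ i : ℕ) : ℤ_[2]) := by push_cast; rfl
  rw [h, digit, map_natCast, ZMod.val_natCast]
  rcases lt_trichotomy j i with hj | rfl | hj
  · rw [if_neg hj.ne, Nat.mod_eq_zero_of_dvd (pow_dvd_pow 2 hj)]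
    simp
  · rw [if_pos rfl, Nat.mod_eq_of_lt (Nat.pow_lt_pow_right one_lt_two j.lt_succ_self),
      Nat.div_self (by positivity)]
  · rw [if_neg hj.ne', Nat.mod_eq_of_lt (Nat.pow_lt_pow_right one_lt_two (by omega)),
      Nat.div_eq_of_lt (Nat.pow_lt_pow_right one_lt_two hj)]

theorem two_dvd_or_two_dvd_sub_one (t : ℤ_[2]) : (2 : ℤ_[2]) ∣ t ∨ (2 : ℤ_[2]) ∣ t - 1 := by
  have h := pow_dvd_sub_sum_digit t 1
  rcases digit_eq_zero_or_one 0 t with h0 | h0 <;> simp [h0] at h <;> tauto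

/-- Two residue classes modulo `2 ^ (n + 1)` lie over each residue class modulo `2 ^ n`. -/
theorem pow_succ_dvd_or_of_pow_dvd {n : ℕ} {z : ℤ_[2]} (h : (2 : ℤ_[2]) ^ n ∣ z) :
    (2 : ℤ_[2]) ^ (n + 1) ∣ z ∨ (2 : ℤ_[2]) ^ (n + 1) ∣ z - 2 ^ n := by
  obtain ⟨t, rfl⟩ := h
  refine (two_dvd_or_two_dvd_sub_one t).imp (fun ht => ?_) (fun ht => ?_)
  · rw [pow_succ]; exact mul_dvd_mul_left _ ht
  · rw [pow_succ, show (2 : ℤ_[2]) ^ n * t - 2 ^ n = 2 ^ n * (t - 1) by ring]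
    exact mul_dvd_mul_left _ ht

theorem not_pow_succ_dvd_of_pow_succ_dvd_sub {n : ℕ} {z : ℤ_[2]}
    (h : (2 : ℤ_[2]) ^ (n + 1) ∣ z - 2 ^ n) : ¬ (2 : ℤ_[2]) ^ (n + 1) ∣ z := fun h' =>
  not_pow_succ_dvd_pow n (by simpa using dvd_sub h' h)

theorem pow_dvd_of_pow_succ_dvd_sub {n : ℕ} {z : ℤ_[2]}
    (h : (2 : ℤ_[2]) ^ (n + 1) ∣ z - 2 ^ n) : (2 : ℤ_[2]) ^ n ∣ z := by
  have := dvd_add ((pow_dvd_pow _ n.le_succ).trans h) (dvd_refl ((2 : ℤ_[2]) ^ n))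
  simpa using this

/-- Adding an odd multiple of `2 ^ n` flips the `n`-th digit. -/
theorem digit_add_digit_eq_one {n : ℕ} {x y : ℤ_[2]}
    (h : (2 : ℤ_[2]) ^ (n + 1) ∣ y - x - 2 ^ n) : digit n x + digit n y = 1 := by
  have hne : digit n x ≠ digit n y := by
    intro he
    have hn := pow_dvd_of_pow_succ_dvd_sub h
    refine not_pow_succ_dvd_of_pow_succ_dvd_sub h (pow_dvd_sub_of_digit_eq fun i hi => ?_)
    rcases Nat.lt_succ_iff_lt_or_eq.1 hi with hi | rfl
    · exact digit_eq_of_pow_dvd_sub hi hn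
    · exact he.symm
  have := digit_lt_two n x
  have := digit_lt_two n y
  omega

theorem norm_le_two_zpow_neg_iff {n : ℕ} {z : ℤ_[2]} :
    ‖z‖ ≤ (2 : ℝ) ^ (-(n : ℤ)) ↔ (2 : ℤ_[2]) ^ n ∣ z := by
  have h := PadicInt.norm_le_pow_iff_mem_span_pow z n
  rw [Ideal.mem_span_singleton] at h
  exact_mod_cast h

/-- `|z|₂ = 2 ^ (-n)` means that `z` is `2 ^ n` times an odd number. -/
theorem norm_eq_two_zpow_neg_iff {n : ℕ} {z : ℤ_[2]} :
    ‖z‖ = (2 : ℝ) ^ (-(n : ℤ)) ↔ (2 : ℤ_[2]) ^ (n + 1) ∣ z - 2 ^ n := by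
  have hlt : ‖z‖ < (2 : ℝ) ^ (-(n : ℤ)) ↔ (2 : ℤ_[2]) ^ (n + 1) ∣ z := by
    rw [← norm_le_two_zpow_neg_iff]
    have := PadicInt.norm_le_pow_iff_norm_lt_pow_add_one z (-((n + 1 : ℕ) : ℤ))
    rw [show -((n + 1 : ℕ) : ℤ) + 1 = -(n : ℤ) by push_cast; ring] at this
    exact_mod_cast this.symm
  constructor
  · intro h
    have h1 := pow_succ_dvd_or_of_pow_dvd (norm_le_two_zpow_neg_iff.1 h.le)
    rw [← hlt] at h1
    exact h1.resolve_left h.not_lt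
  · intro h
    refine le_antisymm (norm_le_two_zpow_neg_iff.2 (pow_dvd_of_pow_succ_dvd_sub h))
      (not_lt.1 fun h' => not_pow_succ_dvd_of_pow_succ_dvd_sub h (hlt.1 h'))

theorem isTFunction_iff {f : ℤ_[2] → ℤ_[2]} :
    IsTFunction f ↔
      ∀ (n : ℕ) (x y : ℤ_[2]), (2 : ℤ_[2]) ^ n ∣ x - y → (2 : ℤ_[2]) ^ n ∣ f x - f y := by
  constructor
  · intro h n x y hxy
    exact pow_dvd_sub_of_digit_eq fun i hi =>
      h i x y fun j hj => digit_eq_of_pow_dvd_sub (hj.trans_lt hi) hxy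
  · intro h i x y hxy
    exact digit_eq_of_pow_dvd_sub i.lt_succ_self
      (h (i + 1) x y (pow_dvd_sub_of_digit_eq fun j hj => hxy j (Nat.lt_succ_iff.1 hj)))

/-! ### Convergence of the series and its truncations -/

theorem isClosed_setOf_pow_dvd_sub (n : ℕ) (s : ℤ_[2]) :
    IsClosed {z : ℤ_[2] | (2 : ℤ_[2]) ^ n ∣ z - s} := by
  simp only [← norm_le_two_zpow_neg_iff]
  exact isClosed_le (by fun_prop) continuous_const

theorem exists_seriesDefines (c : ℤ_[2]) {a : ℕ → ℤ_[2]} (ha : ∀ i, (2 : ℤ_[2]) ^ i ∣ a i) :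
    ∃ f, SeriesDefines c a f := by
  refine ⟨fun x => c + ∑' i, a i * (digit i x : ℤ_[2]), fun x => ?_⟩
  have hs : Summable fun i => a i * (digit i x : ℤ_[2]) := by
    refine Summable.of_norm_bounded (g := fun i => (1 / 2 : ℝ) ^ i) summable_geometric_two
      fun i => ?_
    have h := norm_le_two_zpow_neg_iff.2 ((ha i).mul_right (digit i x : ℤ_[2]))
    simpa using h
  exact hs.hasSum.tendsto_sum_nat.const_add c

namespace SeriesDefines

variable {c : ℤ_[2]} {a : ℕ → ℤ_[2]} {f : ℤ_[2] → ℤ_[2]}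

theorem pow_dvd_sub_truncation (hf : SeriesDefines c a f) (ha : ∀ i, (2 : ℤ_[2]) ^ i ∣ a i)
    (n : ℕ) (x : ℤ_[2]) :
    (2 : ℤ_[2]) ^ n ∣ f x - (c + ∑ i ∈ Finset.range n, a i * (digit i x : ℤ_[2])) := by
  refine (isClosed_setOf_pow_dvd_sub n _).mem_of_tendsto (hf x)
    ((eventually_ge_atTop n).mono fun m hm => ?_)
  simp only [Set.mem_ofPred_eq, add_sub_add_left_eq_sub]
  rw [← Finset.sum_range_add_sum_Ico _ hm, add_sub_cancel_left]
  exact Finset.dvd_sum fun i hi =>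
    ((pow_dvd_pow _ (Finset.mem_Ico.1 hi).1).trans (ha i)).mul_right _

theorem isTFunction (hf : SeriesDefines c a f) (ha : ∀ i, (2 : ℤ_[2]) ^ i ∣ a i) :
    IsTFunction f := by
  rw [isTFunction_iff]
  intro n x y h
  have hs : ∑ i ∈ Finset.range n, a i * (digit i x : ℤ_[2]) =
      ∑ i ∈ Finset.range n, a i * (digit i y : ℤ_[2]) :=
    Finset.sum_congr rfl fun i hi => by
      rw [digit_eq_of_pow_dvd_sub (Finset.mem_range.1 hi) h]
  have := dvd_sub (hf.pow_dvd_sub_truncation ha n x) (hf.pow_dvd_sub_truncation ha n y)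
  rwa [hs, sub_sub_sub_cancel_right] at this

theorem apply_zero (hf : SeriesDefines c a f) : f 0 = c :=
  tendsto_nhds_unique (hf 0) (by simp [digit_zero])

theorem apply_two_pow (hf : SeriesDefines c a f) (i : ℕ) : f (2 ^ i) = c + a i := by
  refine tendsto_nhds_unique (hf (2 ^ i))
    (tendsto_const_nhds.congr' ((eventually_gt_atTop i).mono fun n hn => ?_))
  simp [digit_two_pow, hn]

/-- The coefficients of a T-function satisfy `2 ^ i ∣ a i`, as `a i = f (2 ^ i) - f 0`. -/
theorem pow_dvd_coeff (hf : SeriesDefines c a f) (hT : IsTFunction f) (i : ℕ) :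
    (2 : ℤ_[2]) ^ i ∣ a i := by
  have := isTFunction_iff.1 hT i (2 ^ i) 0 (by simp)
  simpa [hf.apply_zero, hf.apply_two_pow] using this

end SeriesDefines

/-! ### Injectivity and transitivity modulo powers of two -/

namespace SeriesDefines

variable {c : ℤ_[2]} {a : ℕ → ℤ_[2]} {f : ℤ_[2] → ℤ_[2]}

theorem pow_dvd_sub_of_pow_dvd_apply_sub (hf : SeriesDefines c a f)
    (ha : ∀ i, (2 : ℤ_[2]) ^ (i + 1) ∣ a i - 2 ^ i) (n : ℕ) (x y : ℤ_[2])
    (h : (2 : ℤ_[2]) ^ n ∣ f x - f y) : (2 : ℤ_[2]) ^ n ∣ x - y := by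
  induction n with
  | zero => simp
  | succ n ih =>
    have hxy := ih ((pow_dvd_pow _ n.le_succ).trans h)
    have ha' := fun i => pow_dvd_of_pow_succ_dvd_sub (ha i)
    refine pow_dvd_sub_of_digit_eq fun i hi => ?_
    rcases Nat.lt_succ_iff_lt_or_eq.1 hi with hi | rfl
    · exact digit_eq_of_pow_dvd_sub hi hxy
    have hs : ∑ j ∈ Finset.range i, a j * (digit j x : ℤ_[2]) =
        ∑ j ∈ Finset.range i, a j * (digit j y : ℤ_[2]) :=
      Finset.sum_congr rfl fun j hj => by
        rw [digit_eq_of_pow_dvd_sub (Finset.mem_range.1 hj) hxy]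
    have h1 := hf.pow_dvd_sub_truncation ha' (i + 1) x
    have h2 := hf.pow_dvd_sub_truncation ha' (i + 1) y
    rw [Finset.sum_range_succ] at h1 h2
    have h3 : (2 : ℤ_[2]) ^ (i + 1) ∣ a i * ((digit i x : ℤ_[2]) - digit i y) := by
      convert dvd_sub h (dvd_sub h1 h2) using 1
      rw [hs]
      ring
    have hni := not_pow_succ_dvd_of_pow_succ_dvd_sub (ha i)
    rcases digit_eq_zero_or_one i x with hx | hx <;>
      rcases digit_eq_zero_or_one i y with hy | hy <;> simp_all

/-- Modulo `2 ^ (k + 1)`, the increment `f y - y` depends only on the first `k` digits. -/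
theorem pow_succ_dvd_increment (hf : SeriesDefines c a f)
    (ha : ∀ i, (2 : ℤ_[2]) ^ (i + 1) ∣ a i - 2 ^ i) (k : ℕ) (y : ℤ_[2]) :
    (2 : ℤ_[2]) ^ (k + 1) ∣
      f y - y - (c + ∑ i ∈ Finset.range k, (a i - 2 ^ i) * (digit i y : ℤ_[2])) := by
  have h1 := hf.pow_dvd_sub_truncation (fun i => pow_dvd_of_pow_succ_dvd_sub (ha i)) (k + 1) y
  have h2 := pow_dvd_sub_sum_digit y (k + 1)
  rw [Finset.sum_range_succ] at h1 h2
  have h3 := (ha k).mul_right (digit k y : ℤ_[2])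
  convert dvd_add (dvd_sub h1 h2) h3 using 1
  simp only [sub_mul, Finset.sum_sub_distrib]
  ring

theorem pow_succ_dvd_iterate_sub (hf : SeriesDefines c a f)
    (ha : ∀ i, (2 : ℤ_[2]) ^ (i + 1) ∣ a i - 2 ^ i) (k N : ℕ) (x : ℤ_[2]) :
    (2 : ℤ_[2]) ^ (k + 1) ∣ f^[N] x - x - (N * c + ∑ i ∈ Finset.range k,
      (a i - 2 ^ i) * ((∑ j ∈ Finset.range N, digit i (f^[j] x) : ℕ) : ℤ_[2])) := by
  induction N with
  | zero => simp
  | succ N ih =>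
    convert dvd_add ih (hf.pow_succ_dvd_increment ha k (f^[N] x)) using 1
    rw [Function.iterate_succ_apply']
    simp only [Finset.sum_range_succ, Nat.cast_add, mul_add, Finset.sum_add_distrib]
    push_cast
    ring

/-- Each of the first `k` digits equals `1` at exactly half of any `2 ^ k` consecutive points of
an orbit, and `f^[2 ^ k]` adds `2 ^ k` modulo `2 ^ (k + 1)`. The increment formula turns the
first property at `k` into the second one, and the second one pairs `f^[j] x` with
`f^[2 ^ k + j] x`, which differ in the `k`-th digit, to give the first property at `k + 1`. -/
theorem sum_digit_and_iterate (hf : SeriesDefines c a f)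
    (ha : ∀ i, (2 : ℤ_[2]) ^ (i + 1) ∣ a i - 2 ^ i) (hc : (2 : ℤ_[2]) ∣ c - 1)
    (ha0 : (4 : ℤ_[2]) ∣ a 0 - 1) (k : ℕ) :
    (∀ i < k, ∀ x, 2 * ∑ j ∈ Finset.range (2 ^ k), digit i (f^[j] x) = 2 ^ k) ∧
      ∀ x, (2 : ℤ_[2]) ^ (k + 1) ∣ f^[2 ^ k] x - x - 2 ^ k := by
  have ha4 : ∀ i, (4 : ℤ_[2]) ∣ a i - 2 ^ i := by
    intro i
    rcases i with _ | i
    · simpa using ha0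
    · refine (Dvd.intro (2 ^ i) ?_ : (4 : ℤ_[2]) ∣ 2 ^ (i + 1 + 1)).trans (ha (i + 1))
      ring
  have step : ∀ k,
      (∀ i < k, ∀ x, 2 * ∑ j ∈ Finset.range (2 ^ k), digit i (f^[j] x) = 2 ^ k) →
      ∀ x, (2 : ℤ_[2]) ^ (k + 1) ∣ f^[2 ^ k] x - x - 2 ^ k := by
    intro k hk x
    have h1 := hf.pow_succ_dvd_iterate_sub ha k (2 ^ k) x
    have h2 : (2 : ℤ_[2]) ^ (k + 1) ∣ 2 ^ k * (c - 1) := by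
      rw [pow_succ]; exact mul_dvd_mul_left _ hc
    have h3 : (2 : ℤ_[2]) ^ (k + 1) ∣ ∑ i ∈ Finset.range k,
        (a i - 2 ^ i) * ((∑ j ∈ Finset.range (2 ^ k), digit i (f^[j] x) : ℕ) : ℤ_[2]) := by
      refine Finset.dvd_sum fun i hi => ?_
      obtain ⟨t, ht⟩ := ha4 i
      have hs : (2 : ℤ_[2]) * ((∑ j ∈ Finset.range (2 ^ k), digit i (f^[j] x) : ℕ) : ℤ_[2]) =
          2 ^ k := by
        exact_mod_cast congrArg (Nat.cast : ℕ → ℤ_[2]) (hk i (Finset.mem_range.1 hi) x)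
      refine ⟨t, ?_⟩
      rw [ht, pow_succ, ← hs]
      ring
    convert dvd_add h1 (dvd_add h2 h3) using 1
    push_cast
    ring
  suffices h : ∀ k, ∀ i < k, ∀ x,
      2 * ∑ j ∈ Finset.range (2 ^ k), digit i (f^[j] x) = 2 ^ k from ⟨h k, step k (h k)⟩
  intro k
  induction k with
  | zero => simp
  | succ k ih =>
    intro i hi x
    have hsplit : ∑ j ∈ Finset.range (2 ^ (k + 1)), digit i (f^[j] x) =
        ∑ j ∈ Finset.range (2 ^ k), digit i (f^[j] x) +
          ∑ j ∈ Finset.range (2 ^ k), digit i (f^[2 ^ k] (f^[j] x)) := by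
      rw [pow_succ, mul_two, Finset.sum_range_add]
      simp only [Function.iterate_add_apply]
    rcases Nat.lt_succ_iff_lt_or_eq.1 hi with hi | rfl
    · have hcomm : ∀ j, f^[2 ^ k] (f^[j] x) = f^[j] (f^[2 ^ k] x) := fun j => by
        rw [← Function.iterate_add_apply, add_comm, Function.iterate_add_apply]
      simp only [hcomm] at hsplit
      rw [hsplit, mul_add, ih i hi x, ih i hi (f^[2 ^ k] x)]
      ring
    · rw [hsplit, ← Finset.sum_add_distrib,
        Finset.sum_congr rfl fun j _ => digit_add_digit_eq_one (step i ih (f^[j] x))]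
      simp
      ring

/-- Every orbit of `f` visits every residue class modulo `2 ^ n`. -/
theorem exists_iterate_pow_dvd_sub (hf : SeriesDefines c a f)
    (ha : ∀ i, (2 : ℤ_[2]) ^ (i + 1) ∣ a i - 2 ^ i) (hc : (2 : ℤ_[2]) ∣ c - 1)
    (ha0 : (4 : ℤ_[2]) ∣ a 0 - 1) (n : ℕ) (x r : ℤ_[2]) :
    ∃ j, (2 : ℤ_[2]) ^ n ∣ f^[j] x - r := by
  induction n with
  | zero => simp
  | succ n ih =>
    obtain ⟨j, hj⟩ := ih
    rcases pow_succ_dvd_or_of_pow_dvd hj with h | h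
    · exact ⟨j, h⟩
    · refine ⟨2 ^ n + j, ?_⟩
      rw [Function.iterate_add_apply]
      have h1 := (hf.sum_digit_and_iterate ha hc ha0 n).2 (f^[j] x)
      have h2 := dvd_refl ((2 : ℤ_[2]) ^ (n + 1))
      convert dvd_add (dvd_add h1 h) h2 using 1
      ring

end SeriesDefines

/-! ### Residue classes and Haar measure -/

/-- The residue class of `r` modulo `2 ^ n`, which is the closed ball of radius `2 ^ (-n)`
around `r`. -/
def residueClass (n : ℕ) (r : ℤ_[2]) : Set ℤ_[2] := {x | (2 : ℤ_[2]) ^ n ∣ x - r}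

theorem mem_residueClass_self (n : ℕ) (r : ℤ_[2]) : r ∈ residueClass n r := by
  simp [residueClass]

theorem residueClass_eq_of_mem {n : ℕ} {r s : ℤ_[2]} (h : s ∈ residueClass n r) :
    residueClass n s = residueClass n r := by
  ext x
  have h' : (2 : ℤ_[2]) ^ n ∣ s - r := h
  simp only [residueClass, Set.mem_ofPred_eq]
  rw [← sub_add_sub_cancel x s r, dvd_add_left h']

theorem residueClass_subset_of_le {m n : ℕ} (h : m ≤ n) (r : ℤ_[2]) :
    residueClass n r ⊆ residueClass m r := fun _ hx => (pow_dvd_pow _ h).trans hx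

theorem residueClass_eq_closedBall (n : ℕ) (r : ℤ_[2]) :
    residueClass n r = Metric.closedBall r ((2 : ℝ) ^ (-(n : ℤ))) := by
  ext x
  rw [Metric.mem_closedBall, dist_eq_norm, norm_le_two_zpow_neg_iff]
  rfl

theorem isOpen_residueClass (n : ℕ) (r : ℤ_[2]) : IsOpen (residueClass n r) := by
  rw [residueClass_eq_closedBall]
  exact IsUltrametricDist.isOpen_closedBall _ (by positivity)

theorem measurableSet_residueClass (n : ℕ) (r : ℤ_[2]) : MeasurableSet (residueClass n r) :=
  (isOpen_residueClass n r).measurableSet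

theorem borel_eq_generateFrom_residueClass :
    instMeasurableSpace =
      MeasurableSpace.generateFrom {s | ∃ n r, s = residueClass n r} := by
  refine TopologicalSpace.IsTopologicalBasis.borel_eq_generateFrom
    (TopologicalSpace.isTopologicalBasis_of_isOpen_of_nhds ?_ ?_)
  · rintro _ ⟨n, r, rfl⟩
    exact isOpen_residueClass n r
  · intro x u hx hu
    obtain ⟨ε, hε, hsub⟩ := Metric.isOpen_iff.1 hu x hx
    obtain ⟨n, hn⟩ := exists_pow_lt_of_lt_one hε (by norm_num : (1 / 2 : ℝ) < 1)
    refine ⟨_, ⟨n, x, rfl⟩, mem_residueClass_self n x, ?_⟩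
    rw [residueClass_eq_closedBall]
    refine (Metric.closedBall_subset_ball ?_).trans hsub
    simpa using hn

theorem isPiSystem_residueClass : IsPiSystem {s | ∃ n r, s = residueClass n r} := by
  rintro _ ⟨m, r, rfl⟩ _ ⟨n, s, rfl⟩ ⟨x, hxr, hxs⟩
  rw [← residueClass_eq_of_mem hxr, ← residueClass_eq_of_mem hxs]
  rcases le_total m n with h | h
  · exact ⟨n, x, Set.inter_eq_right.2 (residueClass_subset_of_le h x)⟩
  · exact ⟨m, x, Set.inter_eq_left.2 (residueClass_subset_of_le h x)⟩

theorem measure_ext_of_residueClass {μ ν : Measure ℤ_[2]} [IsFiniteMeasure μ]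
    (h : ∀ n r, μ (residueClass n r) = ν (residueClass n r)) : μ = ν := by
  refine ext_of_generate_finite _ borel_eq_generateFrom_residueClass isPiSystem_residueClass ?_ ?_
  · rintro _ ⟨n, r, rfl⟩
    exact h n r
  · simpa [residueClass] using h 0 0

theorem residueClass_eq_preimage (n : ℕ) (r : ℤ_[2]) :
    residueClass n r =
      (PadicInt.toZModPow n : ℤ_[2] → ZMod (2 ^ n)) ⁻¹' {PadicInt.toZModPow n r} := by
  ext x
  exact toZModPow_eq_iff_pow_dvd_sub.symm

/-- A measure giving all residue classes modulo `2 ^ n` the same mass gives each of them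
`2 ^ (-n)` of the total mass. -/
theorem pow_mul_measure_residueClass (μ : Measure ℤ_[2]) {n : ℕ} {r : ℤ_[2]}
    (h : ∀ s, μ (residueClass n s) = μ (residueClass n r)) :
    2 ^ n * μ (residueClass n r) = μ Set.univ := by
  have hcls : ∀ z : ZMod (2 ^ n),
      (PadicInt.toZModPow n : ℤ_[2] → ZMod (2 ^ n)) ⁻¹' {z} = residueClass n (z.val : ℤ_[2]) := by
    intro z
    rw [residueClass_eq_preimage, map_natCast, ZMod.natCast_zmod_val]
  have hsum := sum_measure_preimage_singleton (μ := μ) (Finset.univ : Finset (ZMod (2 ^ n)))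
    (f := (PadicInt.toZModPow n : ℤ_[2] → ZMod (2 ^ n)))
    (fun z _ => by rw [hcls]; exact measurableSet_residueClass _ _)
  simp only [hcls, h, Finset.coe_univ, Set.preimage_univ] at hsum
  rw [← hsum]
  simp [ZMod.card]

instance isAddHaarMeasure_haar : haar.IsAddHaarMeasure := by
  unfold haar
  infer_instance

instance isProbabilityMeasure_haar : IsProbabilityMeasure haar := by
  refine ⟨?_⟩
  have := Measure.addHaarMeasure_self (K₀ := (⊤ : TopologicalSpace.PositiveCompacts ℤ_[2]))
  simpa [haar] using this

theorem haar_residueClass_eq (n : ℕ) (r s : ℤ_[2]) :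
    haar (residueClass n r) = haar (residueClass n s) := by
  rw [← measure_preimage_add haar (r - s) (residueClass n r)]
  congr 1
  ext x
  simp only [residueClass, Set.mem_preimage, Set.mem_ofPred_eq]
  rw [show r - s + x - r = x - s by ring]

/-! ### Ergodicity and the induced maps on residue classes -/

section Sufficiency

variable {f : ℤ_[2] → ℤ_[2]}

theorem preimage_residueClass_apply (hT : IsTFunction f)
    (hinj : ∀ (n : ℕ) (x y : ℤ_[2]), (2 : ℤ_[2]) ^ n ∣ f x - f y → (2 : ℤ_[2]) ^ n ∣ x - y)
    (n : ℕ) (y : ℤ_[2]) : f ⁻¹' residueClass n (f y) = residueClass n y :=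
  Set.ext fun x => ⟨hinj n x y, isTFunction_iff.1 hT n x y⟩

/-- A T-function which is transitive modulo every power of two is ergodic. By transitivity, an
invariant set `s` meets all residue classes modulo `2 ^ n` in the same measure, so the restriction
of Haar measure to `s` is a multiple of Haar measure; evaluating at `s` gives `μ s = μ s * μ s`. -/
theorem IsTFunction.ergodic_of_transitive (hT : IsTFunction f)
    (hinj : ∀ (n : ℕ) (x y : ℤ_[2]), (2 : ℤ_[2]) ^ n ∣ f x - f y → (2 : ℤ_[2]) ^ n ∣ x - y)
    (htrans : ∀ (n : ℕ) (x r : ℤ_[2]), ∃ j, (2 : ℤ_[2]) ^ n ∣ f^[j] x - r) :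
    Ergodic f haar := by
  have hpre := preimage_residueClass_apply hT hinj
  have hsurj : ∀ n r, ∃ y, residueClass n r = residueClass n (f y) := by
    intro n r
    -- starting the orbit at `f r` ensures that the class is met by an image point
    obtain ⟨j, hj⟩ := htrans n (f r) r
    refine ⟨f^[j] r, (residueClass_eq_of_mem ?_).symm⟩
    rwa [← Function.iterate_succ_apply' f, Function.iterate_succ_apply]
  have hmeas : Measurable f := by
    rw [borel_eq_generateFrom_residueClass]
    refine @measurable_generateFrom _ _ (MeasurableSpace.generateFrom _) _ _ ?_
    rintro _ ⟨n, r, rfl⟩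
    obtain ⟨y, hy⟩ := hsurj n r
    rw [hy, hpre]
    exact MeasurableSpace.measurableSet_generateFrom ⟨n, y, rfl⟩
  have hmp : MeasurePreserving f haar haar := by
    refine ⟨hmeas, (measure_ext_of_residueClass fun n r => ?_).symm⟩
    rw [Measure.map_apply hmeas (measurableSet_residueClass n r)]
    obtain ⟨y, hy⟩ := hsurj n r
    rw [hy, hpre]
    exact haar_residueClass_eq _ _ _
  refine ⟨hmp, ⟨fun s hs hinv => ?_⟩⟩
  have hstep : ∀ n y, haar.restrict s (residueClass n (f y)) =
      haar.restrict s (residueClass n y) := by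
    intro n y
    rw [Measure.restrict_apply (measurableSet_residueClass _ _),
      Measure.restrict_apply (measurableSet_residueClass _ _), ← hpre n y]
    conv_rhs => rw [← hinv, ← Set.preimage_inter]
    exact (hmp.measure_preimage
      ((measurableSet_residueClass _ _).inter hs).nullMeasurableSet).symm
  have hconst : ∀ n r t, haar.restrict s (residueClass n t) =
      haar.restrict s (residueClass n r) := by
    intro n r t
    have horbit : ∀ j, haar.restrict s (residueClass n (f^[j] r)) =
        haar.restrict s (residueClass n r) := by
      intro j
      induction j with
      | zero => rfl
      | succ j ih => rw [Function.iterate_succ_apply', hstep, ih]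
    obtain ⟨j, hj⟩ := htrans n r t
    rw [← residueClass_eq_of_mem hj, horbit]
  have hrestrict : haar.restrict s = haar s • haar := by
    refine measure_ext_of_residueClass fun n r => ?_
    have h1 := pow_mul_measure_residueClass (haar.restrict s) (hconst n r)
    have h2 := pow_mul_measure_residueClass haar (fun t => haar_residueClass_eq n t r)
    rw [Measure.restrict_apply_univ] at h1
    rw [measure_univ] at h2
    rw [Measure.smul_apply, smul_eq_mul]
    refine (ENNReal.mul_right_inj (a := 2 ^ n) (by positivity) (by simp)).1 ?_
    rw [h1, mul_left_comm, h2, mul_one]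
  have hsq : haar s = haar s * haar s := by
    have := congrArg (fun μ : Measure ℤ_[2] => μ s) hrestrict
    simpa [Measure.restrict_apply_self] using this
  rw [eventuallyConst_set']
  rcases eq_or_ne (haar s) 0 with h0 | h0
  · exact Or.inl (ae_eq_empty.2 h0)
  · have h1 : haar s = 1 :=
      ((ENNReal.mul_right_inj h0 (measure_ne_top _ _)).1 (by rw [mul_one]; exact hsq)).symm
    exact Or.inr (ae_eq_univ.2 ((prob_compl_eq_zero_iff hs).2 h1))

end Sufficiency

section Necessity

variable {f : ℤ_[2] → ℤ_[2]}

/-- A measure-preserving T-function is injective modulo every power of two: it is surjective on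
residue classes, since these have positive measure, and there are finitely many of them. -/
theorem IsTFunction.pow_dvd_sub_of_measurePreserving (hT : IsTFunction f)
    (hf : MeasurePreserving f haar haar) (n : ℕ) (x y : ℤ_[2])
    (h : (2 : ℤ_[2]) ^ n ∣ f x - f y) : (2 : ℤ_[2]) ^ n ∣ x - y := by
  let g : ZMod (2 ^ n) → ZMod (2 ^ n) := fun z => PadicInt.toZModPow n (f (z.val : ℤ_[2]))
  have hg : ∀ x, g (PadicInt.toZModPow n x) = PadicInt.toZModPow n (f x) := by
    intro x
    rw [toZModPow_eq_iff_pow_dvd_sub]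
    refine isTFunction_iff.1 hT n _ _ (toZModPow_eq_iff_pow_dvd_sub.1 ?_)
    rw [map_natCast, ZMod.natCast_zmod_val]
  have hsurj : Function.Surjective g := by
    intro z
    have hpos : 0 < haar (f ⁻¹' residueClass n (z.val : ℤ_[2])) := by
      rw [hf.measure_preimage (measurableSet_residueClass _ _).nullMeasurableSet]
      exact (isOpen_residueClass _ _).measure_pos _ ⟨_, mem_residueClass_self _ _⟩
    obtain ⟨x, hx⟩ := nonempty_of_measure_ne_zero hpos.ne'
    refine ⟨PadicInt.toZModPow n x, ?_⟩
    rw [hg, toZModPow_eq_iff_pow_dvd_sub.2 hx, map_natCast, ZMod.natCast_zmod_val]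
  have hinj := Finite.injective_iff_surjective.2 hsurj
  rw [← toZModPow_eq_iff_pow_dvd_sub] at h ⊢
  exact hinj (by rw [hg, hg, h])

/-- Under an ergodic map, a nonempty open invariant set meets every nonempty open set. -/
theorem not_disjoint_of_ergodic (hf : Ergodic f haar) {s t : Set ℤ_[2]} (hs : IsOpen s)
    (hs' : s.Nonempty) (hinv : f ⁻¹' s = s) (ht : IsOpen t) (ht' : t.Nonempty) :
    ¬ Disjoint s t := by
  intro hd
  rcases eventuallyConst_set'.1 (hf.aeconst_set hs.measurableSet hinv) with h | h
  · exact (hs.measure_pos haar hs').ne' (ae_eq_empty.1 h)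
  · exact (ht.measure_pos haar ht').ne'
      (measure_mono_null hd.subset_compl_left (ae_eq_univ.1 h))

end Necessity

/-! ### Necessity of the conditions -/

namespace SeriesDefines

variable {c : ℤ_[2]} {a : ℕ → ℤ_[2]} {f : ℤ_[2] → ℤ_[2]}

theorem pow_succ_dvd_coeff_sub (hf : SeriesDefines c a f) (hT : IsTFunction f)
    (hmp : MeasurePreserving f haar haar) (i : ℕ) : (2 : ℤ_[2]) ^ (i + 1) ∣ a i - 2 ^ i := by
  refine (pow_succ_dvd_or_of_pow_dvd (hf.pow_dvd_coeff hT i)).resolve_left fun h => ?_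
  refine not_pow_succ_dvd_pow i ?_
  have := hT.pow_dvd_sub_of_measurePreserving hmp (i + 1) (2 ^ i) 0
    (by simpa [hf.apply_zero, hf.apply_two_pow] using h)
  simpa using this

/-- If `c` were even, the even numbers would form an invariant set. -/
theorem two_dvd_const_sub_one (hf : SeriesDefines c a f) (hT : IsTFunction f)
    (he : Ergodic f haar) : (2 : ℤ_[2]) ∣ c - 1 := by
  refine (two_dvd_or_two_dvd_sub_one c).resolve_left fun hc => ?_
  have hc' : residueClass 1 (f 0) = residueClass 1 0 :=
    residueClass_eq_of_mem (by simpa [residueClass, hf.apply_zero] using hc)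
  have hinv := preimage_residueClass_apply hT
    (hT.pow_dvd_sub_of_measurePreserving he.toMeasurePreserving) 1 0
  rw [hc'] at hinv
  refine not_disjoint_of_ergodic he (isOpen_residueClass 1 0) ⟨_, mem_residueClass_self 1 0⟩ hinv
    (isOpen_residueClass 1 1) ⟨_, mem_residueClass_self 1 1⟩
    (Set.disjoint_left.2 fun x hx hx' => not_pow_succ_dvd_pow 0 ?_)
  have := dvd_sub (show (2 : ℤ_[2]) ^ 1 ∣ x - 0 from hx) (show (2 : ℤ_[2]) ^ 1 ∣ x - 1 from hx')
  simpa using this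

/-- If `a 0` were `3` modulo `4`, then `f` would swap the residue classes of `0` and `c` modulo
`4`, and their union would be an invariant set missing the class of `2`. -/
theorem four_dvd_coeff_zero_sub_one (hf : SeriesDefines c a f) (hT : IsTFunction f)
    (he : Ergodic f haar) : (4 : ℤ_[2]) ∣ a 0 - 1 := by
  have ha := hf.pow_succ_dvd_coeff_sub hT he.toMeasurePreserving
  have hc := hf.two_dvd_const_sub_one hT he
  have h0 := pow_succ_dvd_or_of_pow_dvd (n := 1) (z := a 0 - 1) (by simpa using ha 0)
  norm_num at h0
  refine h0.resolve_right fun h0 => ?_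
  -- the increment at the odd point `c` gives `f c ≡ 2 c + (a 0 - 1) ≡ 2 + 2 ≡ 0` modulo `4`
  have hfc : (2 : ℤ_[2]) ^ 2 ∣ f c := by
    have h1 := hf.pow_succ_dvd_increment ha 1 c
    have hd : digit 0 c = 1 := by
      rw [digit_eq_of_pow_dvd_sub (n := 1) one_pos (y := 2 ^ 0) (by simpa using hc),
        digit_two_pow, if_pos rfl]
    obtain ⟨s, hs⟩ := h0
    obtain ⟨t, ht⟩ := hc
    obtain ⟨u, hu⟩ := h1
    simp [hd] at hu
    refine ⟨u + t + s + 1, ?_⟩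
    linear_combination hu + 2 * ht + hs
  have hpre := preimage_residueClass_apply hT
    (hT.pow_dvd_sub_of_measurePreserving he.toMeasurePreserving) 2
  have hpre0 := hpre 0
  have hprec := hpre c
  rw [hf.apply_zero] at hpre0
  rw [residueClass_eq_of_mem (r := 0) (by simpa [residueClass] using hfc)] at hprec
  have hinv : f ⁻¹' (residueClass 2 0 ∪ residueClass 2 c) =
      residueClass 2 0 ∪ residueClass 2 c := by
    rw [Set.preimage_union, hpre0, hprec, Set.union_comm]
  refine not_disjoint_of_ergodic he ((isOpen_residueClass 2 0).union (isOpen_residueClass 2 c))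
    ⟨_, Or.inl (mem_residueClass_self 2 0)⟩ hinv
    (isOpen_residueClass 2 2) ⟨_, mem_residueClass_self 2 2⟩ (Set.disjoint_left.2 ?_)
  intro x hx hx2
  have hx2' : (2 : ℤ_[2]) ^ 2 ∣ x - 2 := hx2
  rcases hx with hx | hx
  · have := dvd_sub (show (2 : ℤ_[2]) ^ 2 ∣ x - 0 from hx) hx2'
    exact not_pow_succ_dvd_pow 1 (by simpa using this)
  · have h1 := (pow_dvd_pow (2 : ℤ_[2]) one_le_two).trans
      (dvd_sub (show (2 : ℤ_[2]) ^ 2 ∣ x - c from hx) hx2')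
    rw [pow_one] at h1
    refine not_pow_succ_dvd_pow 0 ?_
    convert dvd_sub (dvd_refl (2 : ℤ_[2])) (dvd_add h1 hc) using 1 <;> ring

end SeriesDefines

end TFun

theorem mainTheorem7 (c : ℤ_[2]) (a : ℕ → ℤ_[2]) :
    (∃ f : ℤ_[2] → ℤ_[2],
        TFun.SeriesDefines c a f ∧ TFun.IsTFunction f ∧ Ergodic f TFun.haar) ↔
      ((2 : ℤ_[2]) ∣ c - 1 ∧ (4 : ℤ_[2]) ∣ a 0 - 1 ∧
        ∀ i : ℕ, 1 ≤ i → ‖a i‖ = (2 : ℝ) ^ (-(i : ℤ))) := by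
  constructor
  · rintro ⟨f, hf, hT, he⟩
    exact ⟨hf.two_dvd_const_sub_one hT he, hf.four_dvd_coeff_zero_sub_one hT he, fun i _ =>
      TFun.norm_eq_two_zpow_neg_iff.2 (hf.pow_succ_dvd_coeff_sub hT he.toMeasurePreserving i)⟩
  · rintro ⟨hc, ha0, hnorm⟩
    have ha : ∀ i, (2 : ℤ_[2]) ^ (i + 1) ∣ a i - 2 ^ i := by
      intro i
      rcases i with _ | i
      · simpa using (Dvd.intro 2 (by norm_num) : (2 : ℤ_[2]) ∣ 4).trans ha0
      · exact TFun.norm_eq_two_zpow_neg_iff.1 (hnorm (i + 1) (by omega))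
    have ha' := fun i => TFun.pow_dvd_of_pow_succ_dvd_sub (ha i)
    obtain ⟨f, hf⟩ := TFun.exists_seriesDefines c ha'
    have hT := hf.isTFunction ha'
    exact ⟨f, hf, hT, hT.ergodic_of_transitive (hf.pow_dvd_sub_of_pow_dvd_apply_sub ha)
      (hf.exists_iterate_pow_dvd_sub ha hc ha0)⟩
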